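/- All graphs are finite and simple. Let $G$ be a connected graph of order $n\ge 2$. For a nonempty set $S\subseteq V(G)$ of initially blue vertices (all others white), in each round of (standard) zero forcing every white vertex that is the unique white neighbor of some blue vertex turns blue. Let $\operatorname{pt}(G;S)$ be the least $p\ge 0$ such that all vertices are blue after round $p$, with $\operatorname{pt}(G;S)=\infty$ if there is no such $p$; $S$ is a zero forcing set if $\operatorname{pt}(G;S)<\infty$. Let $\operatorname{pt}(G,k)=\min_{|S|=k}\operatorname{pt}(G;S)$, let $\operatorname{Z}(G)$ be the minimum size of a zero forcing set, and $$\operatorname{th}^\ast(G)=\min_{\operatorname{Z}(G)\le k<n} k\,\operatorname{pt}(G,k).$$ In power domination from a nonempty set $S$, the set of observed vertices is $S$ initially, it is the closed neighborhood $N[S]$ after round $1$, and in every later round each unobserved vertex that is the unique unobserved neighbor of some observed vertex becomes observed. Let $\operatorname{pt}_{\rm pd}(G;S)$ be the least $p\ge 0$ such that all vertices are observed after round $p$ ($\infty$ if there is no such $p$), $\operatorname{pt}_{\rm pd}(G,k)=\min_{|S|=k}\operatorname{pt}_{\rm pd}(G;S)$, and $$\operatorname{th}_{\rm pd}^\ast(G)=\min_{1\le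 k<n} k\,\operatorname{pt}_{\rm pd}(G,k).$$ Let $\gamma(G)$ be the domination number of $G$, i.e. the minimum size of a set $S$ with $N[S]=V(G)$. The corona $H\circ K_1$ of a graph $H$ is obtained from $H$ by appending one new leaf to each vertex of $H$. $C_4$ is the cycle on $4$ vertices and $K_2$ the complete graph on $2$ vertices. Then $$\operatorname{th}^\ast(G)=\frac n2=\gamma(G)=\operatorname{th}_{\rm pd}^\ast(G)$$ if and only if, up to isomorphism, $G=(H\circ K_1)\circ K_1$ for some connected (nonempty) graph $H$, or $G=C_4\circ K_1$, or $G=C_4$, or $G=K_2$. -/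

import Mathlib

open scoped ENNReal

universe u

namespace SimpleGraph

variable {V : Type*}

/-- One round of the standard color change rule: every vertex `w` that is the unique white
neighbor of some blue vertex `v` turns blue (`B` is the set of blue vertices). -/
def zfStep (G : SimpleGraph V) (B : Set V) : Set V :=
  B ∪ {w | ∃ v ∈ B, G.neighborSet v \ B = {w}}

/-- The set of vertices that are blue after round `i` of standard zero forcing from `S`. -/
def zfBlue (G : SimpleGraph V) (S : Set V) : ℕ → Set V
  | 0 => S
  | i + 1 => G.zfStep (G.zfBlue S i)

/-- `S` is a (standard) zero forcing set. -/
def IsZeroForcing (G : SimpleGraph V) (S : Set V) : Prop :=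
  S.Nonempty ∧ ∃ p, G.zfBlue S p = Set.univ

/-- The propagation time `pt(G; S)`: the least `p` such that all vertices are blue after
round `p`, and `∞` if there is none. -/
noncomputable def propTime (G : SimpleGraph V) (S : Set V) : ℕ∞ :=
  ⨅ (p : ℕ) (_ : G.zfBlue S p = Set.univ), (p : ℕ∞)

/-- `pt(G, k)`: the minimum of `pt(G; S)` over the sets `S` of `k` vertices. -/
noncomputable def propTimeCard (G : SimpleGraph V) (k : ℕ) : ℕ∞ :=
  ⨅ (S : Finset V) (_ : S.card = k), G.propTime (S : Set V)

/-- The zero forcing number `Z(G)`. -/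
noncomputable def zeroForcingNumber (G : SimpleGraph V) : ℕ :=
  sInf {k | ∃ S : Finset V, S.card = k ∧ G.IsZeroForcing (S : Set V)}

/-- The product throttling number for standard zero forcing with no initial cost,
the minimum of `k * pt(G, k)` over `Z(G) ≤ k < n`. -/
noncomputable def prodThrottling [Fintype V] (G : SimpleGraph V) : ℕ∞ :=
  ⨅ (k : ℕ) (_ : G.zeroForcingNumber ≤ k ∧ k < Fintype.card V), (k : ℕ∞) * G.propTimeCard k

/-- The closed neighborhood `N[S]` of a set of vertices. -/
def closedNbhd (G : SimpleGraph V) (S : Set V) : Set V :=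
  S ∪ {w | ∃ v ∈ S, G.Adj v w}

/-- The domination number: the least size of a set `S` with `N[S] = V(G)`. -/
noncomputable def dominationNumber (G : SimpleGraph V) : ℕ :=
  sInf {k | ∃ S : Finset V, S.card = k ∧ G.closedNbhd (S : Set V) = Set.univ}

/-- The set of vertices observed after round `i` of power domination from `S`:
a domination step first, then zero forcing steps. -/
def pdObserved (G : SimpleGraph V) (S : Set V) : ℕ → Set V
  | 0 => S
  | i + 1 => G.zfBlue (G.closedNbhd S) i

/-- The power propagation time `pt_pd(G; S)`: the least nonnegative `p` such that all vertices
are observed after round `p`, and `∞` if there is none. -/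
noncomputable def powerPropTime (G : SimpleGraph V) (S : Set V) : ℕ∞ :=
  ⨅ (p : ℕ) (_ : G.pdObserved S p = Set.univ), (p : ℕ∞)

/-- `pt_pd(G, k)`: the minimum of `pt_pd(G; S)` over the sets `S` of `k` vertices. -/
noncomputable def powerPropTimeCard (G : SimpleGraph V) (k : ℕ) : ℕ∞ :=
  ⨅ (S : Finset V) (_ : S.card = k), G.powerPropTime (S : Set V)

/-- The product power throttling number with no initial cost,
the minimum of `k * pt_pd(G, k)` over `1 ≤ k < n`. -/
noncomputable def prodPowerThrottling [Fintype V] (G : SimpleGraph V) : ℕ∞ :=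
  ⨅ (k : ℕ) (_ : 1 ≤ k ∧ k < Fintype.card V), (k : ℕ∞) * G.powerPropTimeCard k

/-- The adjacency relation of the corona of `H` with `K₁`; `Sum.inr u` is the leaf appended
to the vertex `Sum.inl u`. -/
def coronaAdj (H : SimpleGraph V) : V ⊕ V → V ⊕ V → Prop
  | Sum.inl u, Sum.inl v => H.Adj u v
  | Sum.inl u, Sum.inr v => u = v
  | Sum.inr u, Sum.inl v => u = v
  | Sum.inr _, Sum.inr _ => False

/-- The corona `H ∘ K₁`: a leaf is appended to each vertex of `H`. -/
def corona (H : SimpleGraph V) : SimpleGraph (V ⊕ V) where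
  Adj := H.coronaAdj
  symm := ⟨by
    rintro (u | u) (v | v) h
    · exact SimpleGraph.Adj.symm h
    · exact Eq.symm h
    · exact Eq.symm h
    · exact h⟩
  loopless := ⟨by
    rintro (u | u) h
    · exact H.irrefl h
    · exact h⟩

end SimpleGraph

/-! Zero forcing from k vertices colors at most k vertices per round, so n ≤ k(1 + p); as k < n
forces p ≥ 1, always kp ≥ n/2. Hence all the equalities hold once some n/2 vertices force the rest
in one round (`HalfForces`) and th_pd* ≥ n/2 (`HalfThrottled`). Conversely, th_pd* = n/2 alone
determines the graph.

One round of power domination is domination, so `HalfThrottled` gives γ ≥ n/2. A connected graph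
with γ ≥ n/2 is C₄ or a corona (`HalfDominated.cycle_or_corona`): Hall's theorem matches a minimum
dominating set with its complement, and an exchange argument (`HalfDominated.eq_of_adj`) makes every
matching edge contain a leaf, unless the graph is C₄.

For a corona of H, th_pd* ≥ n/2 is equivalent to γ(H) ≥ |H|/2: dominating H suffices to observe the
corona in two rounds, and no number of rounds makes up for not dominating H. So the classification
applies again to H, which is C₄, a corona, or a single vertex (giving K₂). -/

namespace SimpleGraph

/-! ### Forcing and domination: membership and isomorphism invariance -/

section Basic

variable {V : Type*} {V' : Type*} {G : SimpleGraph V} {G' : SimpleGraph V'}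

theorem mem_zfStep {B : Set V} {w : V} :
    w ∈ G.zfStep B ↔ w ∈ B ∨ ∃ v ∈ B, ∀ x, (G.Adj v x ∧ x ∉ B) ↔ x = w := by
  simp only [zfStep, Set.mem_union, Set.mem_ofPred_eq, Set.ext_iff, Set.mem_sdiff, mem_neighborSet,
    Set.mem_singleton_iff]

theorem mem_closedNbhd {S : Set V} {w : V} :
    w ∈ G.closedNbhd S ↔ w ∈ S ∨ ∃ v ∈ S, G.Adj v w := Iff.rfl

theorem closedNbhd_eq_univ_iff {S : Set V} :
    G.closedNbhd S = Set.univ ↔ ∀ w, w ∈ S ∨ ∃ v ∈ S, G.Adj v w := by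
  simp only [Set.eq_univ_iff_forall, mem_closedNbhd]

theorem zfStep_subset_closedNbhd (S : Set V) : G.zfStep S ⊆ G.closedNbhd S := by
  intro w hw
  rcases mem_zfStep.1 hw with h | ⟨v, hv, h⟩
  · exact Or.inl h
  · exact Or.inr ⟨v, hv, ((h w).2 rfl).1⟩

theorem subset_zfStep (B : Set V) : B ⊆ G.zfStep B := Set.subset_union_left

theorem zfStep_preimage (e : G ≃g G') (B : Set V') :
    G.zfStep (e ⁻¹' B) = e ⁻¹' G'.zfStep B := by
  ext w
  simp only [mem_zfStep, Set.mem_preimage]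
  refine or_congr_right ⟨?_, ?_⟩
  · rintro ⟨v, hv, h⟩
    refine ⟨e v, hv, fun y => ?_⟩
    obtain ⟨x, rfl⟩ := e.surjective y
    rw [e.map_adj_iff, h, e.injective.eq_iff]
  · rintro ⟨v, hv, h⟩
    obtain ⟨v, rfl⟩ := e.surjective v
    refine ⟨v, hv, fun x => ?_⟩
    rw [← e.map_adj_iff, h, e.injective.eq_iff]

theorem zfBlue_preimage (e : G ≃g G') (B : Set V') (i : ℕ) :
    G.zfBlue (e ⁻¹' B) i = e ⁻¹' G'.zfBlue B i := by
  induction i with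
  | zero => rfl
  | succ i ih => simp only [zfBlue, ih, zfStep_preimage]

theorem closedNbhd_preimage (e : G ≃g G') (B : Set V') :
    G.closedNbhd (e ⁻¹' B) = e ⁻¹' G'.closedNbhd B := by
  ext w
  simp only [mem_closedNbhd, Set.mem_preimage]
  refine or_congr_right ⟨?_, ?_⟩
  · rintro ⟨v, hv, h⟩
    exact ⟨e v, hv, e.map_adj_iff.2 h⟩
  · rintro ⟨v, hv, h⟩
    obtain ⟨v, rfl⟩ := e.surjective v
    exact ⟨v, hv, e.map_adj_iff.1 h⟩

theorem pdObserved_preimage (e : G ≃g G') (B : Set V') (i : ℕ) :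
    G.pdObserved (e ⁻¹' B) i = e ⁻¹' G'.pdObserved B i := by
  cases i with
  | zero => rfl
  | succ i => simp only [pdObserved, closedNbhd_preimage, zfBlue_preimage]

theorem propTimeCard_le {S : Finset V} {p : ℕ} (h : G.zfBlue (S : Set V) p = Set.univ) :
    G.propTimeCard S.card ≤ p :=
  le_trans (b := G.propTime S) (iInf₂_le (f := fun (T : Finset V) (_ : T.card = S.card) =>
    G.propTime (T : Set V)) S rfl) (iInf₂_le p h)

theorem powerPropTimeCard_le {S : Finset V} {p : ℕ}
    (h : G.pdObserved (S : Set V) p = Set.univ) : G.powerPropTimeCard S.card ≤ p :=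
  le_trans (b := G.powerPropTime S) (iInf₂_le (f := fun (T : Finset V) (_ : T.card = S.card) =>
    G.powerPropTime (T : Set V)) S rfl) (iInf₂_le p h)

end Basic

/-! ### Reformulations by vertex sets, and the bound for zero forcing -/

section Properties

variable {V : Type*} [Fintype V] {V' : Type*} [Fintype V']

/-- Half of the vertices force all the others in a single round of zero forcing. -/
def HalfForces (G : SimpleGraph V) : Prop :=
  ∃ S : Finset V, 2 * S.card = Fintype.card V ∧ G.zfStep (S : Set V) = Set.univ

/-- Every dominating set contains at least half of the vertices. -/
def HalfDominated (G : SimpleGraph V) : Prop :=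
  ∀ S : Finset V, G.closedNbhd (S : Set V) = Set.univ → Fintype.card V ≤ 2 * S.card

/-- The product of the size of a proper power dominating set and the number of rounds it needs
is at least half of the number of vertices. -/
def HalfThrottled (G : SimpleGraph V) : Prop :=
  ∀ (S : Finset V) (p : ℕ), 1 ≤ S.card → S.card < Fintype.card V →
    G.pdObserved (S : Set V) p = Set.univ → Fintype.card V ≤ 2 * (S.card * p)

variable {G : SimpleGraph V} {G' : SimpleGraph V'}

theorem HalfForces.of_iso (h : G'.HalfForces) (e : G ≃g G') : G.HalfForces := by
  obtain ⟨S, hc, hS⟩ := h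
  refine ⟨S.map e.symm.toEquiv.toEmbedding, ?_, ?_⟩
  · rw [Finset.card_map, hc, Fintype.card_congr e.toEquiv]
  · have : ((S.map e.symm.toEquiv.toEmbedding : Finset V) : Set V) = e ⁻¹' (S : Set V') := by
      ext x
      simp only [Finset.coe_map, Set.mem_image, Set.mem_preimage, Finset.mem_coe]
      constructor
      · rintro ⟨y, hy, rfl⟩
        simpa using hy
      · intro hx
        exact ⟨e x, hx, e.symm_apply_apply x⟩
    rw [this, zfStep_preimage, hS, Set.preimage_univ]

theorem HalfThrottled.of_iso (h : G'.HalfThrottled) (e : G ≃g G') : G.HalfThrottled := by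
  intro S p h1 h2 hS
  have hc := Fintype.card_congr e.toEquiv
  have hp : (S : Set V) = e ⁻¹' ((S.map e.toEquiv.toEmbedding : Finset V') : Set V') := by
    ext x
    simp only [Finset.coe_map, Set.mem_image, Set.mem_preimage, Finset.mem_coe]
    constructor
    · intro hx
      exact ⟨x, hx, rfl⟩
    · rintro ⟨y, hy, hxy⟩
      rwa [← e.injective hxy]
  have := h (S.map e.toEquiv.toEmbedding) p (by simpa using h1)
    (by rw [Finset.card_map]; omega) (by
      rw [hp, pdObserved_preimage] at hS
      refine Set.eq_univ_iff_forall.2 fun y => ?_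
      obtain ⟨x, rfl⟩ := e.surjective y
      exact Set.eq_univ_iff_forall.1 hS x)
  rw [Finset.card_map] at this
  omega

theorem HalfThrottled.halfDominated [Nonempty V] (h : G.HalfThrottled) : G.HalfDominated := by
  intro S hS
  have h0 : 1 ≤ S.card := by
    rw [Nat.one_le_iff_ne_zero, Ne, Finset.card_eq_zero]
    rintro rfl
    obtain ⟨w⟩ := ‹Nonempty V›
    simpa using closedNbhd_eq_univ_iff.1 hS w
  rcases lt_or_ge S.card (Fintype.card V) with h1 | h1
  · simpa using h S 1 h0 h1 hS
  · omega

/-- Zero rounds would need all vertices and one round is domination. From two rounds on, the factor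
`p + 2 ≥ 2` makes n/4 vertices enough. -/
theorem halfThrottled_of_le {G : SimpleGraph V} (h1 : G.HalfDominated)
    (h2 : ∀ (S : Finset V) (p : ℕ), 1 ≤ S.card → G.pdObserved (S : Set V) (p + 2) = Set.univ →
      Fintype.card V ≤ 4 * S.card) : G.HalfThrottled := by
  intro S p hS hS' h
  match p, h with
  | 0, h =>
    have : S = Finset.univ := Finset.coe_eq_univ.1 h
    rw [this, Finset.card_univ] at hS'
    omega
  | 1, h => simpa using h1 S h
  | p + 2, h =>
    have := h2 S p hS h
    nlinarith

/-- The number of blue vertices with a white neighbor never exceeds the number of initially blue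
vertices, so each round colors at most that many vertices. -/
theorem ncard_zfBlue_le (G : SimpleGraph V) (S : Set V) (i : ℕ) :
    {v ∈ G.zfBlue S i | ∃ x, G.Adj v x ∧ x ∉ G.zfBlue S i}.ncard ≤ S.ncard ∧
      (G.zfBlue S i).ncard ≤ S.ncard * (1 + i) := by
  induction i with
  | zero =>
    exact ⟨Set.ncard_le_ncard (fun v hv => hv.1), by simp [zfBlue]⟩
  | succ i ih =>
    obtain ⟨ih1, ih2⟩ := ih
    set B := G.zfBlue S i with hB
    have hB' : G.zfBlue S (i + 1) = G.zfStep B := rfl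
    rw [hB']
    set A := {v ∈ B | ∃ x, G.Adj v x ∧ x ∉ B} with hA
    set N := G.zfStep B \ B with hN
    have hforce : ∀ w, w ∈ N → ∃ v ∈ B, ∀ x, (G.Adj v x ∧ x ∉ B) ↔ x = w := by
      rintro w ⟨hw, hw'⟩
      exact (mem_zfStep.1 hw).resolve_left hw'
    choose! f hfB hf using hforce
    -- A forcing vertex has a single white neighbor, so it determines the vertex it forces.
    have hfi : Set.InjOn f N := by
      intro w hw w' hw' h
      have h1 := (hf w hw w).2 rfl
      rw [h] at h1
      exact (hf w' hw' w).1 h1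
    have hfA : f '' N ⊆ A := by
      rintro _ ⟨w, hw, rfl⟩
      exact ⟨hfB w hw, w, (hf w hw w).2 rfl⟩
    have hcard : (f '' N).ncard = N.ncard := hfi.ncard_image
    have hle : N.ncard ≤ A.ncard := hcard ▸ Set.ncard_le_ncard hfA
    have hdiff : (A \ f '' N).ncard + N.ncard = A.ncard := by
      rw [← hcard]
      exact Set.ncard_sdiff_add_ncard_of_subset hfA
    constructor
    -- A vertex that forces has no white neighbor left: each newly blue vertex replaces its forcer
    -- among the active ones.
    · refine le_trans (Set.ncard_le_ncard (t := (A \ f '' N) ∪ N) ?_) ?_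
      · rintro v ⟨hv, x, hvx, hx⟩
        have hxB : x ∉ B := fun h => hx (subset_zfStep _ h)
        by_cases hvB : v ∈ B
        · refine Or.inl ⟨⟨hvB, x, hvx, hxB⟩, ?_⟩
          rintro ⟨w, hw, rfl⟩
          have := (hf w hw x).1 ⟨hvx, hxB⟩
          exact hx (this ▸ hw.1)
        · exact Or.inr ⟨hv, hvB⟩
      · exact (Set.ncard_union_le _ _).trans (hdiff.le.trans ih1)
    · have h1 : (G.zfStep B).ncard ≤ B.ncard + N.ncard := by
        have : G.zfStep B = B ∪ N := (Set.union_sdiff_cancel (subset_zfStep B)).symm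
        conv_lhs => rw [this]
        exact Set.ncard_union_le _ _
      nlinarith

theorem card_le_of_zfBlue_eq_univ {S : Finset V} {p : ℕ} (hS : S.card < Fintype.card V)
    (h : G.zfBlue (S : Set V) p = Set.univ) : Fintype.card V ≤ 2 * (S.card * p) := by
  have h1 := (G.ncard_zfBlue_le (S : Set V) p).2
  rw [h, Set.ncard_univ, Nat.card_eq_fintype_card, Set.ncard_coe_finset] at h1
  rcases Nat.eq_zero_or_pos p with rfl | hp
  · omega
  · nlinarith

end Properties

/-! ### From vertex sets to the throttling numbers -/

section Invariants

variable {V : Type*} [Fintype V] {G : SimpleGraph V}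

theorem le_prodThrottling [Nonempty V] (G : SimpleGraph V) {h : ℕ}
    (hh : 2 * h = Fintype.card V) : (h : ℕ∞) ≤ G.prodThrottling := by
  refine le_iInf₂ fun k hk => ?_
  -- `k ≠ 0` is essential: in `ℕ∞` the product `0 * ⊤` is `0`.
  have hZ : 1 ≤ G.zeroForcingNumber := by
    obtain ⟨S, hS, hS'⟩ := Nat.sInf_mem (s := {k | ∃ S : Finset V, S.card = k ∧
      G.IsZeroForcing (S : Set V)}) ⟨_, Finset.univ, rfl, by simp, 0, by simp [zfBlue]⟩
    rw [zeroForcingNumber, ← hS]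
    exact Finset.card_pos.2 (by simpa using hS'.1)
  have hk0 : 1 ≤ k := hZ.trans hk.1
  rcases eq_or_ne (G.propTimeCard k) ⊤ with ht | ht
  · rw [ht, ENat.mul_top (by exact_mod_cast (by omega : k ≠ 0))]
    exact le_top
  · obtain ⟨x, hx⟩ := ENat.ne_top_iff_exists.1 ht
    -- The strict bound by `x + 1` lets `iInf_lt_iff` extract a set and a time realizing the
    -- infimum.
    have hlt : G.propTimeCard k < ((x + 1 : ℕ) : ℕ∞) := by
      rw [← hx]; exact_mod_cast Nat.lt_succ_self x
    simp only [propTimeCard, propTime, iInf_lt_iff] at hlt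
    obtain ⟨S, hS, p, hp, hpx⟩ := hlt
    rw [← hx]
    have hpx' : p < x + 1 := by exact_mod_cast hpx
    have := card_le_of_zfBlue_eq_univ (by omega) hp
    rw [hS] at this
    have h2 : k * p ≤ k * x := Nat.mul_le_mul_left _ (by omega)
    exact_mod_cast (by omega : h ≤ k * x)

theorem prodPowerThrottling_le {S : Finset V} {p : ℕ} (h1 : 1 ≤ S.card)
    (h2 : S.card < Fintype.card V) (h : G.pdObserved (S : Set V) p = Set.univ) :
    G.prodPowerThrottling ≤ (S.card * p : ℕ) := by
  refine (iInf₂_le S.card ⟨h1, h2⟩).trans ?_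
  rw [Nat.cast_mul]
  exact mul_le_mul_right (powerPropTimeCard_le h) _

theorem HalfThrottled.le_prodPowerThrottling (hG : G.HalfThrottled) {h : ℕ}
    (hh : 2 * h = Fintype.card V) : (h : ℕ∞) ≤ G.prodPowerThrottling := by
  refine le_iInf₂ fun k hk => ?_
  rcases eq_or_ne (G.powerPropTimeCard k) ⊤ with ht | ht
  · rw [ht, ENat.mul_top (by exact_mod_cast (by omega : k ≠ 0))]
    exact le_top
  · obtain ⟨x, hx⟩ := ENat.ne_top_iff_exists.1 ht
    have hlt : G.powerPropTimeCard k < ((x + 1 : ℕ) : ℕ∞) := by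
      rw [← hx]; exact_mod_cast Nat.lt_succ_self x
    simp only [powerPropTimeCard, powerPropTime, iInf_lt_iff] at hlt
    obtain ⟨S, hS, p, hp, hpx⟩ := hlt
    rw [← hx]
    have hpx' : p < x + 1 := by exact_mod_cast hpx
    have := hG S p (by omega) (by omega) hp
    rw [hS] at this
    have h2 : k * p ≤ k * x := Nat.mul_le_mul_left _ (by omega)
    exact_mod_cast (by omega : h ≤ k * x)

/-- The set that forces everything in one round also dominates, so it attains n/2 for all three
parameters. -/
theorem HalfForces.invariants [Nonempty V] (hF : G.HalfForces) (hT : G.HalfThrottled) :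
    (G.prodThrottling : ℝ≥0∞) = (Fintype.card V : ℝ≥0∞) / 2 ∧
      (Fintype.card V : ℝ≥0∞) / 2 = (G.dominationNumber : ℝ≥0∞) ∧
      (G.dominationNumber : ℝ≥0∞) = (G.prodPowerThrottling : ℝ≥0∞) := by
  obtain ⟨S, hc, hS⟩ := hF
  have hpos := Fintype.card_pos (α := V)
  have h1 : 1 ≤ S.card := by omega
  have h2 : S.card < Fintype.card V := by omega
  have hdom : G.closedNbhd (S : Set V) = Set.univ :=
    Set.univ_subset_iff.1 (hS ▸ zfStep_subset_closedNbhd _)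
  have hd : G.dominationNumber = S.card := by
    refine le_antisymm (Nat.sInf_le ⟨S, rfl, hdom⟩) ?_
    obtain ⟨D, hD, hD'⟩ := Nat.sInf_mem (s := {k | ∃ S : Finset V, S.card = k ∧
      G.closedNbhd (S : Set V) = Set.univ}) ⟨_, S, rfl, hdom⟩
    have := hT.halfDominated D hD'
    rw [dominationNumber, ← hD]
    omega
  have hp : G.prodPowerThrottling = (S.card : ℕ∞) := by
    refine le_antisymm ?_ (hT.le_prodPowerThrottling hc)
    simpa using prodPowerThrottling_le (p := 1) h1 h2 hdom
  have ht : G.prodThrottling = (S.card : ℕ∞) := by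
    refine le_antisymm ?_ (G.le_prodThrottling hc)
    have hz : G.zeroForcingNumber ≤ S.card :=
      Nat.sInf_le ⟨S, rfl, by simpa using Finset.card_pos.1 h1, 1, hS⟩
    refine (iInf₂_le S.card ⟨hz, h2⟩).trans ?_
    calc (S.card : ℕ∞) * G.propTimeCard S.card ≤ S.card * ((1 : ℕ) : ℕ∞) :=
          mul_le_mul_right (propTimeCard_le (p := 1) hS) _
      _ = S.card := by simp
  have hn : (Fintype.card V : ℝ≥0∞) / 2 = (S.card : ℝ≥0∞) := by
    rw [← hc, Nat.cast_mul, mul_comm, Nat.cast_ofNat]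
    exact ENNReal.mul_div_cancel_right (by simp) (by simp)
  rw [hp, ht, hd, hn]
  simp

theorem halfThrottled_of_prodPowerThrottling_eq
    (h : (Fintype.card V : ℝ≥0∞) / 2 = (G.prodPowerThrottling : ℝ≥0∞)) : G.HalfThrottled := by
  intro S p h1 h2 hS
  have h3 : (G.prodPowerThrottling : ℝ≥0∞) ≤ ((S.card * p : ℕ) : ℝ≥0∞) := by
    have := ENat.toENNReal_le.2 (prodPowerThrottling_le h1 h2 hS)
    rwa [ENat.toENNReal_coe] at this
  rw [← h, ENNReal.div_le_iff (by simp) (by simp)] at h3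
  have h4 : Fintype.card V ≤ S.card * p * 2 := by exact_mod_cast h3
  omega

end Invariants

/-! ### Perfect matchings from minimum dominating sets -/

section Matching

variable {V : Type*} [Fintype V] {G : SimpleGraph V}

theorem exists_minimum_dominating (G : SimpleGraph V) :
    ∃ D : Finset V, G.closedNbhd (D : Set V) = Set.univ ∧
      ∀ D' : Finset V, G.closedNbhd (D' : Set V) = Set.univ → D.card ≤ D'.card := by
  obtain ⟨D, hD, hmin⟩ := Set.exists_min_image
    {D : Finset V | G.closedNbhd (D : Set V) = Set.univ} Finset.card (Set.toFinite _)
    ⟨Finset.univ, by simp [closedNbhd]⟩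
  exact ⟨D, hD, hmin⟩

open Classical in
/-- A minimum dominating set of a graph without isolated vertices can be matched into its
complement. -/
theorem exists_injective_of_minimum_dominating (hiso : ∀ v, ∃ w, G.Adj v w) {D : Finset V}
    (hD : G.closedNbhd (D : Set V) = Set.univ)
    (hmin : ∀ D' : Finset V, G.closedNbhd (D' : Set V) = Set.univ → D.card ≤ D'.card) :
    ∃ f : D → V, Function.Injective f ∧ ∀ v : D, G.Adj v (f v) ∧ f v ∉ D := by
  rw [closedNbhd_eq_univ_iff] at hD
  -- Otherwise `a` could be erased: it has a neighbor in `D`, and no vertex outside `D` relies on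
  -- it.
  have hout : ∀ a ∈ D, ∃ x, G.Adj a x ∧ x ∉ D := by
    intro a ha
    by_contra! hcon
    obtain ⟨b, hab⟩ := hiso a
    have := hmin (D.erase a) (closedNbhd_eq_univ_iff.2 fun w => by
      simp only [Finset.coe_erase, Set.mem_sdiff, Finset.mem_coe, Set.mem_singleton_iff]
      by_cases hwa : w = a
      · subst hwa
        exact Or.inr ⟨b, ⟨hcon b hab, hab.ne'⟩, hab.symm⟩
      · by_cases hw : w ∈ D
        · exact Or.inl ⟨hw, hwa⟩
        · obtain ⟨v, hv, hvw⟩ := (hD w).resolve_left hw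
          refine Or.inr ⟨v, ⟨hv, ?_⟩, hvw⟩
          rintro rfl
          exact hw (hcon w hvw))
    have h2 := Finset.card_erase_lt_of_mem ha
    omega
  have hall := (Finset.all_card_le_biUnion_card_iff_exists_injective
    (fun v : D => Finset.univ.filter fun x => G.Adj v x ∧ x ∉ D)).1 (by
      intro A
      set N := A.biUnion fun v : D => Finset.univ.filter fun x => G.Adj v x ∧ x ∉ D with hN
      have hNm : ∀ x, x ∈ N ↔ ∃ v ∈ A, G.Adj v x ∧ x ∉ D := by
        intro x; simp [hN]
      set A' := A.map (Function.Embedding.subtype _) with hA'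
      have hA'm : ∀ x, x ∈ A' ↔ ∃ h : x ∈ D, (⟨x, h⟩ : D) ∈ A := by
        intro x; simp [hA']
      have hsub : A' ⊆ D := fun x hx => ((hA'm x).1 hx).1
      -- Hall's condition: replacing `A'` by its outer neighbors `N` keeps the set dominating, so
      -- minimality gives |A| ≤ |N|.
      have := hmin ((D \ A') ∪ N) (closedNbhd_eq_univ_iff.2 fun w => by
        simp only [Finset.mem_coe, Finset.mem_union, Finset.mem_sdiff]
        by_cases hwA : w ∈ A'
        · obtain ⟨hw, hwA⟩ := (hA'm w).1 hwA
          obtain ⟨x, hx, hxD⟩ := hout w hw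
          exact Or.inr ⟨x, Or.inr ((hNm x).2 ⟨_, hwA, hx, hxD⟩), hx.symm⟩
        · by_cases hw : w ∈ D
          · exact Or.inl (Or.inl ⟨hw, hwA⟩)
          · obtain ⟨v, hv, hvw⟩ := (hD w).resolve_left hw
            by_cases hvA : v ∈ A'
            · obtain ⟨hv', hvA⟩ := (hA'm v).1 hvA
              exact Or.inl (Or.inr ((hNm w).2 ⟨_, hvA, hvw, hw⟩))
            · exact Or.inr ⟨v, Or.inl ⟨hv, hvA⟩, hvw⟩)
      have h1 := Finset.card_union_le (D \ A') N
      have h2 := Finset.card_sdiff_add_card_eq_card hsub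
      have h3 : A'.card = A.card := Finset.card_map _
      omega)
  obtain ⟨f, hf, hf'⟩ := hall
  exact ⟨f, hf, fun v => by simpa using hf' v⟩

/-- If every dominating set contains at least half of the vertices and there are no isolated
vertices, then there is a perfect matching, each of whose edges has exactly one end in some
set. -/
theorem HalfDominated.exists_matching (hG : G.HalfDominated) (hiso : ∀ v, ∃ w, G.Adj v w) :
    ∃ (σ : V → V) (P : V → Prop), Function.Involutive σ ∧ (∀ v, G.Adj v (σ v)) ∧
      ∀ v, P (σ v) ↔ ¬ P v := by
  classical
  obtain ⟨D, hD, hmin⟩ := G.exists_minimum_dominating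
  obtain ⟨f, hf, hf'⟩ := exists_injective_of_minimum_dominating hiso hD hmin
  have hcard := hG D hD
  let g : D → (Dᶜ : Finset V) := fun v => ⟨f v, Finset.mem_compl.2 (hf' v).2⟩
  have hg : Function.Injective g := fun v w h => hf (Subtype.ext_iff.1 h)
  have hc : (Dᶜ : Finset V).card = Fintype.card V - D.card := Finset.card_compl D
  have hgb : Function.Bijective g := (Fintype.bijective_iff_injective_and_card g).2 ⟨hg, by
    have := Fintype.card_le_of_injective g hg
    simp only [Fintype.card_coe] at this ⊢
    omega⟩
  let e : D ≃ (Dᶜ : Finset V) := Equiv.ofBijective g hgb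
  let σ : V → V := fun v => if h : v ∈ D then e ⟨v, h⟩ else e.symm ⟨v, Finset.mem_compl.2 h⟩
  have hσ1 : ∀ v (h : v ∈ D), σ v = e ⟨v, h⟩ := fun v h => dif_pos h
  have hσ2 : ∀ v (h : v ∉ D), σ v = e.symm ⟨v, Finset.mem_compl.2 h⟩ := fun v h => dif_neg h
  have hm1 : ∀ v, v ∈ D → σ v ∉ D := fun v h => by
    rw [hσ1 v h]; exact Finset.mem_compl.1 (e ⟨v, h⟩).2
  have hm2 : ∀ v, v ∉ D → σ v ∈ D := fun v h => by
    rw [hσ2 v h]; exact (e.symm _).2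
  have hinv : Function.Involutive σ := by
    intro v
    by_cases h : v ∈ D
    · rw [hσ2 _ (hm1 v h)]
      simp only [hσ1 v h, Subtype.coe_eta, Equiv.symm_apply_apply]
    · rw [hσ1 _ (hm2 v h)]
      simp only [hσ2 v h, Subtype.coe_eta, Equiv.apply_symm_apply]
  have hadj : ∀ v ∈ D, G.Adj v (σ v) := fun v h => by
    rw [hσ1 v h]; exact (hf' ⟨v, h⟩).1
  refine ⟨σ, (· ∈ D), hinv, fun v => ?_, fun v => ⟨fun h h' => hm1 v h' h, hm2 v⟩⟩
  by_cases h : v ∈ D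
  · exact hadj v h
  · have := hadj _ (hm2 v h)
    rw [hinv v] at this
    exact this.symm

/-- In a perfect matching of a graph in which every dominating set contains at least half of the
vertices, outer neighbors of the two ends of a matching edge are matched to each other. -/
theorem HalfDominated.eq_of_adj (hG : G.HalfDominated) {σ : V → V} {P : V → Prop}
    (hσ : Function.Involutive σ) (hadj : ∀ v, G.Adj v (σ v)) (hP : ∀ v, P (σ v) ↔ ¬ P v)
    {a c d : V} (hc : G.Adj a c) (hca : c ≠ σ a) (hd : G.Adj (σ a) d) (hda : d ≠ a) :
    d = σ c := by
  classical
  by_contra hdc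
  have hcd : ∀ v, σ v = c ↔ v = σ c := fun v => ⟨fun h => by rw [← h, hσ], fun h => by rw [h, hσ]⟩
  have hcd' : ∀ v, σ v = d ↔ v = σ d := fun v => ⟨fun h => by rw [← h, hσ], fun h => by rw [h, hσ]⟩
  have hca' : c ≠ a := hc.ne'
  have hda' : d ≠ σ a := hd.ne'
  have hne : ∀ v, σ v ≠ v := fun v => (hadj v).ne'
  -- Discard the edge `{a, σ a}`; take `c` and `d` from their own edges and the `P`-end of every
  -- other edge. This dominates with fewer than n/2 vertices.
  set D : Finset V := Finset.univ.filter fun v =>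
    (v ≠ a ∧ v ≠ σ a) ∧ (v = c ∨ v = d ∨ (P v ∧ σ v ≠ c ∧ σ v ≠ d)) with hD
  have hDm : ∀ v, v ∈ D ↔ (v ≠ a ∧ v ≠ σ a) ∧ (v = c ∨ v = d ∨ (P v ∧ σ v ≠ c ∧ σ v ≠ d)) := by
    intro v; simp [hD]
  have hcD : c ∈ D := (hDm c).2 ⟨⟨hca', hca⟩, Or.inl rfl⟩
  have hdD : d ∈ D := (hDm d).2 ⟨⟨hda, hda'⟩, Or.inr (Or.inl rfl)⟩
  have hdom := hG D (closedNbhd_eq_univ_iff.2 fun w => by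
    by_cases hwa : w = a
    · subst hwa; exact Or.inr ⟨c, hcD, hc.symm⟩
    by_cases hwa' : w = σ a
    · subst hwa'; exact Or.inr ⟨d, hdD, hd.symm⟩
    by_cases hw : w ∈ D
    · exact Or.inl hw
    · refine Or.inr ⟨σ w, (hDm _).2 ⟨⟨?_, ?_⟩, ?_⟩, (hadj w).symm⟩
      · intro h; exact hwa' (by rw [← h, hσ])
      · exact fun h => hwa (hσ.injective h)
      · rw [hDm, hσ] at *
        have := hP w
        tauto)
  -- No edge has both ends in `D`; this is where `d ≠ σ c` enters.
  have hdisj : Disjoint D (D.image σ) := by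
    rw [Finset.disjoint_left]
    intro v hv hv'
    obtain ⟨w, hw, rfl⟩ := Finset.mem_image.1 hv'
    have h1 := ((hDm _).1 hw).2
    have h2 := ((hDm _).1 hv).2
    rw [hσ] at h2
    have h3 := hP w
    have h4 : w = c → σ w ≠ c ∧ σ w ≠ d := by
      rintro rfl; exact ⟨hne w, fun h => hdc h.symm⟩
    have h5 : w = d → σ w ≠ c ∧ σ w ≠ d := by
      rintro rfl; exact ⟨fun h => hdc (by rw [← h, hσ]), hne w⟩
    tauto
  have hsub : D ∪ D.image σ ⊆ (Finset.univ.erase a).erase (σ a) := by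
    intro v hv
    simp only [Finset.mem_erase, Finset.mem_univ, and_true]
    rcases Finset.mem_union.1 hv with h | h
    · exact ((hDm _).1 h).1.symm
    · obtain ⟨w, hw, rfl⟩ := Finset.mem_image.1 h
      obtain ⟨h1, h2⟩ := ((hDm _).1 hw).1
      exact ⟨fun h => h1 (hσ.injective h), fun h => h2 (by rw [← h, hσ])⟩
  have h1 := Finset.card_le_card hsub
  rw [Finset.card_union_of_disjoint hdisj, Finset.card_image_of_injective _ hσ.injective,
    Finset.card_erase_of_mem (by simpa using hne a), Finset.card_erase_of_mem (by simp),
    Finset.card_univ] at h1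
  have h2 : 0 < D.card := Finset.card_pos.2 ⟨c, hcD⟩
  omega

end Matching

/-! ### Coronas: isomorphism and connectedness -/

section Corona

variable {W : Type*} {W' : Type*} {H : SimpleGraph W} {H' : SimpleGraph W'}

@[simp] theorem corona_adj_inl_inl {u v : W} : H.corona.Adj (Sum.inl u) (Sum.inl v) ↔ H.Adj u v :=
  Iff.rfl

@[simp] theorem corona_adj_inl_inr {u v : W} : H.corona.Adj (Sum.inl u) (Sum.inr v) ↔ u = v :=
  Iff.rfl

@[simp] theorem corona_adj_inr_inl {u v : W} : H.corona.Adj (Sum.inr u) (Sum.inl v) ↔ u = v :=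
  Iff.rfl

@[simp] theorem corona_adj_inr_inr {u v : W} : ¬ H.corona.Adj (Sum.inr u) (Sum.inr v) :=
  id

/-- Isomorphic graphs have isomorphic coronas. -/
def coronaCongr (e : H ≃g H') : H.corona ≃g H'.corona where
  toEquiv := Equiv.sumCongr e.toEquiv e.toEquiv
  map_rel_iff' := by
    rintro (u | u) (v | v) <;> simp [e.map_adj_iff]

/-- The base vertex of a vertex of a corona. -/
def coronaBase : W ⊕ W → W := Sum.elim id id

/-- Projecting to base vertices sends each edge to an edge or to a single vertex, so walks project.
-/
theorem Connected.of_corona (h : H.corona.Connected) : H.Connected := by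
  have key : ∀ x y, H.corona.Reachable x y → H.Reachable (coronaBase x) (coronaBase y) := by
    rintro x y ⟨w⟩
    induction w with
    | nil => exact Reachable.refl _
    | @cons x z y hxz _ ih =>
      refine Reachable.trans ?_ ih
      rcases x with x | x <;> rcases z with z | z
      · exact (corona_adj_inl_inl.1 hxz).reachable
      · obtain rfl := corona_adj_inl_inr.1 hxz
        exact Reachable.refl _
      · obtain rfl := corona_adj_inr_inl.1 hxz
        exact Reachable.refl _
      · exact (corona_adj_inr_inr hxz).elim
  have : Nonempty W := h.nonempty.map coronaBase
  exact ⟨fun u v => key (Sum.inl u) (Sum.inl v) (h.preconnected _ _)⟩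

end Corona

/-! ### Connected graphs with domination number at least n/2 -/

section Structure

theorem isoCycleGraphFour {V : Type*} {G : SimpleGraph V} (hG : G.Connected) {a b c d : V}
    (ha : ∀ x, G.Adj a x ↔ x = b ∨ x = c) (hb : ∀ x, G.Adj b x ↔ x = a ∨ x = d)
    (hc : ∀ x, G.Adj c x ↔ x = a ∨ x = d) (hd : ∀ x, G.Adj d x ↔ x = b ∨ x = c)
    (hbc : b ≠ c) (had : a ≠ d) : Nonempty (G ≃g cycleGraph 4) := by
  have hab : a ≠ b := ((ha b).2 (Or.inl rfl)).ne
  have hac : a ≠ c := ((ha c).2 (Or.inr rfl)).ne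
  have hbd : b ≠ d := ((hb d).2 (Or.inr rfl)).ne
  have hcd : c ≠ d := ((hc d).2 (Or.inr rfl)).ne
  let f : Fin 4 → V := ![a, b, d, c]
  -- The four vertices have no neighbors besides each other, so by connectedness they are all.
  have hall : ∀ x, x = a ∨ x = b ∨ x = c ∨ x = d := by
    have key : ∀ x y, G.Walk x y → y = a → x = a ∨ x = b ∨ x = c ∨ x = d := by
      intro x y w hy
      induction w with
      | nil => exact Or.inl hy
      | @cons x z y hxz _ ih =>
      have h := hxz.symm
      rcases ih hy with rfl | rfl | rfl | rfl
      · have := (ha x).1 h; tauto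
      · have := (hb x).1 h; tauto
      · have := (hc x).1 h; tauto
      · have := (hd x).1 h; tauto
    intro x
    obtain ⟨w⟩ := hG.preconnected x a
    exact key x a w rfl
  have hf : Function.Bijective f := by
    constructor
    · intro i j h
      fin_cases i <;> fin_cases j <;> simp_all [f, eq_comm]
    · intro x
      rcases hall x with rfl | rfl | rfl | rfl
      exacts [⟨0, rfl⟩, ⟨1, rfl⟩, ⟨3, rfl⟩, ⟨2, rfl⟩]
  refine ⟨Iso.symm ⟨Equiv.ofBijective f hf, ?_⟩⟩
  intro i j
  have key : (cycleGraph 4).Adj i j ↔ (i = 0 ∨ i = 2) ∧ (j = 1 ∨ j = 3) ∨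
      (i = 1 ∨ i = 3) ∧ (j = 0 ∨ j = 2) := by
    revert i j; decide
  rw [key]
  change G.Adj (f i) (f j) ↔ _
  fin_cases i <;> simp only [f] <;> fin_cases j <;> simp_all [eq_comm]

theorem isoCorona_of_leaves {V : Type u} {G : SimpleGraph V} {σ : V → V}
    (hσ : Function.Involutive σ) (hadj : ∀ v, G.Adj v (σ v)) (Q : V → Prop)
    (hQ : ∀ v, Q (σ v) ↔ ¬ Q v) (hleaf : ∀ v, ¬ Q v → ∀ x, G.Adj v x → x = σ v) :
    Nonempty (G ≃g (G.induce {v | Q v}).corona) := by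
  let f : {v | Q v} ⊕ {v | Q v} → V := Sum.elim (fun v => v) (fun v => σ v)
  have hf : Function.Bijective f := by
    constructor
    · rintro (⟨u, hu : Q u⟩ | ⟨u, hu : Q u⟩) (⟨v, hv : Q v⟩ | ⟨v, hv : Q v⟩) h
      · simpa [f] using h
      · exact absurd hv ((hQ v).1 ((show u = σ v from h) ▸ hu))
      · exact absurd hu ((hQ u).1 ((show σ u = v from h) ▸ hv))
      · simpa [f] using hσ.injective (show σ u = σ v from h)
    · intro v
      by_cases hv : Q v
      · exact ⟨Sum.inl ⟨v, hv⟩, rfl⟩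
      · exact ⟨Sum.inr ⟨σ v, (hQ v).2 hv⟩, hσ v⟩
  have hl : ∀ u v, Q v → (G.Adj u (σ v) ↔ u = v) := by
    refine fun u v hv => ⟨fun h => ?_, fun h => h ▸ hadj u⟩
    rw [hleaf (σ v) (fun h' => (hQ v).1 h' hv) u h.symm, hσ]
  refine ⟨Iso.symm ⟨Equiv.ofBijective f hf, ?_⟩⟩
  rintro (⟨u, hu : Q u⟩ | ⟨u, hu : Q u⟩) (⟨v, hv : Q v⟩ | ⟨v, hv : Q v⟩)
  · simp [f]
  · simpa [f] using hl u v hv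
  · simpa [f, G.adj_comm, eq_comm] using hl v u hu
  · simp only [Equiv.ofBijective_apply, f, Sum.elim_inr, hl _ _ hv, corona_adj_inr_inr, iff_false]
    rintro rfl
    exact (hQ u).1 hv hu

/-- A connected graph in which every dominating set contains at least half of the vertices is
a 4-cycle or a corona. -/
theorem HalfDominated.cycle_or_corona {V : Type u} [Fintype V] {G : SimpleGraph V}
    (h : G.HalfDominated) (hG : G.Connected) (hn : 2 ≤ Fintype.card V) :
    Nonempty (G ≃g cycleGraph 4) ∨ ∃ (W : Type u) (H : SimpleGraph W), H.Connected ∧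
      Nonempty (G ≃g H.corona) := by
  have : Nontrivial V := Fintype.one_lt_card_iff_nontrivial.1 hn
  obtain ⟨σ, P, hσ, hadj, hP⟩ := h.exists_matching hG.preconnected.exists_adj_of_nontrivial
  by_cases hl : ∀ v, (∀ x, G.Adj v x → x = σ v) ∨ ∀ x, G.Adj (σ v) x → x = v
  · right
    let L : V → Prop := fun v => ∀ x, G.Adj v x → x = σ v
    have hL : ∀ v, L v ∨ L (σ v) := fun v => (hl v).imp_right fun h x hx => by rw [hσ, h x hx]
    -- The base end of an edge is its non-leaf; if both ends are leaves, `P` breaks the tie.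
    obtain ⟨e⟩ := isoCorona_of_leaves hσ hadj (fun v => ¬ L v ∨ (L (σ v) ∧ P v))
      (fun v => by
        have := hL v; have := hP v
        rw [hσ]; tauto)
      (fun v hv => by
        have : L v := by tauto
        exact this)
    exact ⟨_, _, Connected.of_corona (e.connected_iff.1 hG), ⟨e⟩⟩
  · left
    push Not at hl
    obtain ⟨a, ⟨c, hac, hca⟩, d, had, hda⟩ := hl
    have E := fun {a c d : V} => h.eq_of_adj hσ hadj hP (a := a) (c := c) (d := d)
    obtain rfl : d = σ c := E hac hca had hda
    have hcσ : σ c ≠ a := hda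
    have hac' : a ≠ σ c := hda.symm
    have hbc : σ a ≠ σ c := had.ne
    -- With one outer neighbor at the other end of the edge fixed, `E` determines the outer neighbor
    -- at this end, so every degree is 2.
    have ha : ∀ x, G.Adj a x ↔ x = σ a ∨ x = c := by
      refine fun x => ⟨fun hx => ?_, ?_⟩
      · by_cases hxa : x = σ a
        · exact Or.inl hxa
        · exact Or.inr (hσ.injective (E hx hxa had hda)).symm
      · rintro (rfl | rfl)
        exacts [hadj a, hac]
    have hb : ∀ x, G.Adj (σ a) x ↔ x = a ∨ x = σ c := by
      refine fun x => ⟨fun hx => ?_, ?_⟩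
      · by_cases hxa : x = a
        · exact Or.inl hxa
        · exact Or.inr (E hac hca hx hxa)
      · rintro (rfl | rfl)
        exacts [(hadj _).symm, had]
    have hc : ∀ x, G.Adj c x ↔ x = a ∨ x = σ c := by
      refine fun x => ⟨fun hx => ?_, ?_⟩
      · by_cases hxc : x = σ c
        · exact Or.inr hxc
        · exact Or.inl (hσ.injective (E hx hxc had.symm hca.symm)).symm
      · rintro (rfl | rfl)
        exacts [hac.symm, hadj c]
    have hd : ∀ x, G.Adj (σ c) x ↔ x = σ a ∨ x = c := by
      refine fun x => ⟨fun hx => ?_, ?_⟩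
      · by_cases hxc : x = c
        · exact Or.inr hxc
        · exact Or.inl (E hac.symm hac' hx hxc)
      · rintro (rfl | rfl)
        exacts [had.symm, (hadj _).symm]
    exact isoCycleGraphFour hG ha hb hc hd (Ne.symm hca) hac'

end Structure

/-! ### Power domination in coronas -/

section CoronaThrottling

variable {W : Type*} [Fintype W] {H : SimpleGraph W}

theorem halfForces_of_exists {V : Type*} [Fintype V] {G : SimpleGraph V} (S : Finset V)
    (hc : 2 * S.card = Fintype.card V)
    (h : ∀ w ∉ S, ∃ v ∈ S, ∀ x, (G.Adj v x ∧ x ∉ S) ↔ x = w) : G.HalfForces := by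
  refine ⟨S, hc, Set.eq_univ_iff_forall.2 fun w => mem_zfStep.2 ?_⟩
  by_cases hw : w ∈ S
  · exact Or.inl hw
  · exact Or.inr (h w hw)

theorem halfForces_corona (H : SimpleGraph W) : H.corona.HalfForces := by
  refine halfForces_of_exists (Finset.univ.map Function.Embedding.inl) ?_ ?_
  · rw [Finset.card_map, Finset.card_univ, Fintype.card_sum, two_mul]
  · rintro (w | w) hw
    · simp at hw
    · refine ⟨Sum.inl w, by simp, ?_⟩
      rintro (x | x) <;> simp [eq_comm]

/-- Each leaf is dominated only by itself or by its base, so a dominating set meets every pair of a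
base and its leaf. -/
theorem halfDominated_corona (H : SimpleGraph W) : H.corona.HalfDominated := by
  classical
  intro S hS
  rw [closedNbhd_eq_univ_iff] at hS
  have : S.image coronaBase = Finset.univ := by
    refine Finset.eq_univ_iff_forall.2 fun u => Finset.mem_image.2 ?_
    rcases hS (Sum.inr u) with h | ⟨v | v, hv, h⟩
    · exact ⟨_, h, rfl⟩
    · exact ⟨_, hv, h⟩
    · exact (corona_adj_inr_inr h).elim
  have h2 := Finset.card_image_le (s := S) (f := coronaBase)
  rw [this, Finset.card_univ] at h2
  rw [Fintype.card_sum]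
  omega

omit [Fintype W] in
/-- In a corona, power domination never observes a base vertex outside the closed neighborhood
of the projection of the initial set. -/
theorem mem_closedNbhd_of_mem_zfBlue (S : Set (W ⊕ W)) (i : ℕ) :
    (∀ u, Sum.inl u ∈ H.corona.zfBlue (H.corona.closedNbhd S) i →
      u ∈ H.closedNbhd (coronaBase '' S)) ∧
    ∀ u, Sum.inr u ∈ H.corona.zfBlue (H.corona.closedNbhd S) i →
      Sum.inl u ∈ H.corona.zfBlue (H.corona.closedNbhd S) i ∧
      (u ∈ coronaBase '' S ∨
        ∀ x, H.Adj u x → Sum.inl x ∈ H.corona.zfBlue (H.corona.closedNbhd S) i) := by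
  induction i with
  | zero =>
    simp only [zfBlue]
    constructor
    · rintro u (h | ⟨v | v, hv, h⟩)
      · exact Or.inl ⟨_, h, rfl⟩
      · exact Or.inr ⟨v, ⟨_, hv, rfl⟩, h⟩
      · exact Or.inl ⟨_, hv, h⟩
    · rintro u (h | ⟨v | v, hv, h⟩)
      · exact ⟨Or.inr ⟨_, h, rfl⟩, Or.inl ⟨_, h, rfl⟩⟩
      · obtain rfl := corona_adj_inl_inr.1 h
        exact ⟨Or.inl hv, Or.inl ⟨_, hv, rfl⟩⟩
      · exact (corona_adj_inr_inr h).elim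
  | succ i ih =>
    obtain ⟨ih1, ih2⟩ := ih
    simp only [zfBlue]
    set B := H.corona.zfBlue (H.corona.closedNbhd S) i
    have hB := H.corona.subset_zfStep B
    constructor
    · intro u hu
      rcases mem_zfStep.1 hu with h | ⟨v | v, hv, h⟩
      · exact ih1 u h
      · obtain ⟨h1, h2⟩ := (h (Sum.inl u)).2 rfl
        have h3 : Sum.inr v ∈ B := by
          by_contra hcon
          simpa using (h (Sum.inr v)).1 ⟨rfl, hcon⟩
        rcases (ih2 v h3).2 with h4 | h4
        · exact Or.inr ⟨v, h4, h1⟩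
        · exact absurd (h4 u h1) h2
      · obtain ⟨h1, h2⟩ := (h (Sum.inl u)).2 rfl
        obtain rfl := corona_adj_inr_inl.1 h1
        exact absurd (ih2 v hv).1 h2
    · intro u hu
      rcases mem_zfStep.1 hu with h | ⟨v | v, hv, h⟩
      · exact ⟨hB (ih2 u h).1, (ih2 u h).2.imp_right fun h x hx => hB (h x hx)⟩
      · obtain ⟨h1, h2⟩ := (h (Sum.inr u)).2 rfl
        obtain rfl := corona_adj_inl_inr.1 h1
        refine ⟨hB hv, Or.inr fun x hx => hB ?_⟩
        by_contra hcon
        simpa using (h (Sum.inl x)).1 ⟨hx, hcon⟩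
      · exact (corona_adj_inr_inr ((h (Sum.inr u)).2 rfl).1).elim

theorem HalfDominated.halfThrottled_corona (h : H.HalfDominated) : H.corona.HalfThrottled := by
  classical
  refine halfThrottled_of_le H.halfDominated_corona fun S p _ hS => ?_
  have h1 := h (S.image coronaBase) (Set.eq_univ_iff_forall.2 fun u => by
    rw [Finset.coe_image]
    exact (mem_closedNbhd_of_mem_zfBlue (S : Set (W ⊕ W)) (p + 1)).1 u
      (Set.eq_univ_iff_forall.1 hS _))
  have h2 := Finset.card_image_le (s := S) (f := coronaBase)
  rw [Fintype.card_sum]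
  omega

/-- A dominating set of `H` observes all bases in round one, and each base then forces its leaf in
round two. -/
theorem HalfThrottled.halfDominated_of_corona [Nonempty W] (h : H.corona.HalfThrottled) :
    H.HalfDominated := by
  intro D hD
  have hpos := Fintype.card_pos (α := W)
  have hDc := Finset.card_le_univ D
  rw [closedNbhd_eq_univ_iff] at hD
  have h0 : 1 ≤ D.card := by
    obtain ⟨w⟩ := ‹Nonempty W›
    refine Finset.card_pos.2 ?_
    rcases hD w with h | ⟨v, h, -⟩
    exacts [⟨_, h⟩, ⟨_, h⟩]
  have hl : ∀ w, Sum.inl w ∈ H.corona.closedNbhd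
      ((D.map Function.Embedding.inl : Finset (W ⊕ W)) : Set (W ⊕ W)) := by
    intro w
    rcases hD w with h | ⟨v, hv, h⟩
    · exact Or.inl (by simpa using h)
    · exact Or.inr ⟨Sum.inl v, by simpa using hv, h⟩
  have := h (D.map Function.Embedding.inl) 2 (by simpa using h0)
    (by rw [Finset.card_map, Fintype.card_sum]; omega) (by
      refine Set.eq_univ_iff_forall.2 fun w => mem_zfStep.2 ?_
      by_cases hw : w ∈ H.corona.closedNbhd
          ((D.map Function.Embedding.inl : Finset (W ⊕ W)) : Set (W ⊕ W))
      · exact Or.inl hw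
      rcases w with w | w
      · exact Or.inl (hl w)
      refine Or.inr ⟨Sum.inl w, hl w, ?_⟩
      rintro (x | x)
      · exact ⟨fun h => (h.2 (hl x)).elim, fun h => by cases h⟩
      · simp only [corona_adj_inl_inr, Sum.inr.injEq]
        exact ⟨fun h => h.1.symm, by rintro rfl; exact ⟨rfl, hw⟩⟩)
  rw [Finset.card_map, Fintype.card_sum] at this
  omega

end CoronaThrottling

/-! ### The exceptional graphs C₄ and K₂ -/

section SmallGraphs

theorem halfForces_cycleGraph_four : (cycleGraph 4).HalfForces :=
  -- Two adjacent vertices of the cycle each force their other neighbor.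
  halfForces_of_exists {0, 1} (by decide) (by decide)

theorem halfDominated_cycleGraph_four : (cycleGraph 4).HalfDominated := by
  intro S hS
  rw [closedNbhd_eq_univ_iff] at hS
  have key : ∀ S : Finset (Fin 4), (∀ w, w ∈ S ∨ ∃ v ∈ S, (cycleGraph 4).Adj v w) →
      Fintype.card (Fin 4) ≤ 2 * S.card := by decide
  exact key S hS

theorem halfThrottled_cycleGraph_four : (cycleGraph 4).HalfThrottled :=
  halfThrottled_of_le halfDominated_cycleGraph_four fun S p hS _ => by
    rw [Fintype.card_fin]; omega

theorem halfForces_completeGraph_two : (completeGraph (Fin 2)).HalfForces :=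
  halfForces_of_exists {0} (by decide) (by simp [completeGraph])

theorem halfThrottled_completeGraph_two : (completeGraph (Fin 2)).HalfThrottled := by
  intro S p h1 h2 h
  rw [Fintype.card_fin] at *
  rcases Nat.eq_zero_or_pos p with rfl | hp
  · have : S = Finset.univ := Finset.coe_eq_univ.1 h
    rw [this, Finset.card_univ, Fintype.card_fin] at h2
    omega
  · nlinarith

theorem isoCompleteGraphTwo_of_subsingleton {W : Type*} [Subsingleton W] [Nonempty W]
    (H : SimpleGraph W) : Nonempty (H.corona ≃g completeGraph (Fin 2)) := by
  obtain ⟨w⟩ := ‹Nonempty W›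
  let f : Fin 2 → W ⊕ W := ![Sum.inl w, Sum.inr w]
  have hf : Function.Bijective f := by
    constructor
    · intro i j h
      fin_cases i <;> fin_cases j <;> simp_all [f]
    · rintro (x | x)
      · exact ⟨0, by simp [f, Subsingleton.elim w x]⟩
      · exact ⟨1, by simp [f, Subsingleton.elim w x]⟩
  refine ⟨Iso.symm ⟨Equiv.ofBijective f hf, ?_⟩⟩
  intro i j
  fin_cases i <;> fin_cases j <;> simp [f]

end SmallGraphs

end SimpleGraph

open SimpleGraph in
theorem mainTheorem12 {V : Type u} [Fintype V] (G : SimpleGraph V) (hG : G.Connected)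
    (hn : 2 ≤ Fintype.card V) :
    ((G.prodThrottling : ℝ≥0∞) = (Fintype.card V : ℝ≥0∞) / 2 ∧
      (Fintype.card V : ℝ≥0∞) / 2 = (G.dominationNumber : ℝ≥0∞) ∧
      (G.dominationNumber : ℝ≥0∞) = (G.prodPowerThrottling : ℝ≥0∞)) ↔
    ((∃ (W : Type u) (H : SimpleGraph W), H.Connected ∧ Nonempty (G ≃g H.corona.corona)) ∨
      Nonempty (G ≃g (SimpleGraph.cycleGraph 4).corona) ∨
      Nonempty (G ≃g SimpleGraph.cycleGraph 4) ∨
      Nonempty (G ≃g SimpleGraph.completeGraph (Fin 2))) := by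
  have : Nonempty V := hG.nonempty
  constructor
  · rintro ⟨-, h1, h2⟩
    have hT : G.HalfThrottled := halfThrottled_of_prodPowerThrottling_eq (h1.trans h2)
    rcases hT.halfDominated.cycle_or_corona hG hn with h | ⟨W, H, hH, ⟨e⟩⟩
    · exact Or.inr (Or.inr (Or.inl h))
    have : Nonempty W := hH.nonempty
    have : Finite W := Finite.of_injective (fun w => e.symm (Sum.inl w))
      (e.symm.injective.comp Sum.inl_injective)
    have : Fintype W := Fintype.ofFinite W
    rcases le_or_gt (Fintype.card W) 1 with hW | hW
    · have : Subsingleton W := Fintype.card_le_one_iff_subsingleton.1 hW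
      obtain ⟨e'⟩ := isoCompleteGraphTwo_of_subsingleton H
      exact Or.inr (Or.inr (Or.inr ⟨e.trans e'⟩))
    -- Throttling of the corona passes down to domination of `H`, so the classification applies a
    -- second time.
    rcases (hT.of_iso e.symm).halfDominated_of_corona.cycle_or_corona hH hW with
      ⟨⟨e'⟩⟩ | ⟨W', H', hH', ⟨e'⟩⟩
    · exact Or.inr (Or.inl ⟨e.trans (coronaCongr e')⟩)
    · exact Or.inl ⟨W', H', hH', ⟨e.trans (coronaCongr e')⟩⟩
  · rintro (⟨W, H, -, ⟨e⟩⟩ | ⟨⟨e⟩⟩ | ⟨⟨e⟩⟩ | ⟨⟨e⟩⟩)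
    · have : Finite W := Finite.of_injective (fun w => e.symm (Sum.inl (Sum.inl w)))
        (e.symm.injective.comp (Sum.inl_injective.comp Sum.inl_injective))
      have : Fintype W := Fintype.ofFinite W
      exact (H.corona.halfForces_corona.of_iso e).invariants
        (H.halfDominated_corona.halfThrottled_corona.of_iso e)
    · exact ((halfForces_corona _).of_iso e).invariants
        (halfDominated_cycleGraph_four.halfThrottled_corona.of_iso e)
    · exact (halfForces_cycleGraph_four.of_iso e).invariants
        (halfThrottled_cycleGraph_four.of_iso e)
    · exact (halfForces_completeGraph_two.of_iso e).invariants
        (halfThrottled_completeGraph_two.of_iso e)
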